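/- **Theorem (Erdős–Rado classes are minimal amongst the large $L_{\infty,\omega}$-elementary categories).** *Conventions.* Languages are sets of finitary function and relation symbols. An *abstract class* $\mathcal K$ in a language $\tau(\mathcal K)$ is an isomorphism-closed class of $\tau(\mathcal K)$-structures with an isomorphism-invariant partial order $\le_{\mathcal K}$ contained in the substructure relation. A $\mathcal K$-embedding $f:I\to J$ is an embedding with $f(I)\le_{\mathcal K}J$; $\mathcal K$ is a category with these morphisms. It is *ordered* if a distinguished binary symbol $<$ is a strict total order on every member. Tuples $\mathbf a\in I\in\mathcal K$ and $\mathbf b\in J\in\mathcal K$ of the same finite length have the same type, $tp_{\mathcal K}(\mathbf a;I)=tp_{\mathcal K}(\mathbf b;J)$, if they are connected by a finite zigzag of $\mathcal K$-embeddings. $S_{\mathcal K}$ is the class of all types, $S^{inc}_{\mathcal K}$ the class of types of increasing tuples, and for $p=tp_{\mathcal K}(a_1,\dots,a_n;I)$ and $s=\{k_1<\dots<k_m\}\subseteq\{1,\dots,n\}$, $p^s=tp_{\mathcal K}(a_{k_1},\dots,a_{k_m};I)$. For a language $\tau_1$, $tp_{\tau_1}$ and $S_{\tau_1}$ refer to the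 class of all $\tau_1$-structures with substructure (so $tp_{\tau_1}$ is the quantifier-free type). A *bigness notion* $\mathbf g$ for $\mathcal K$ assigns to each cardinal $\mu$ a subclass of $\mathcal K$, the $\mu$-big members, such that if $M\le_{\mathcal K}N$, $\mu_1\le\mu_2$ and $M$ is $\mu_2$-big, then $N$ is $\mu_1$-big, and every $\aleph_0$-big member realizes every type in $S_{\mathcal K}$. A *blueprint* $\Phi$ proper for $\mathcal K$, with language $\tau_1=\tau(\Phi)$, is a map $\Phi:S^{inc}_{\mathcal K}\to S_{\tau_1}$ taking types of $n$-tuples to types of $n$-tuples with $\Phi(p^s)=\Phi(p)^s$. $EM(I,\Phi)$ is the $\tau_1$-structure (unique up to isomorphism, if it exists) containing $I$ as a subset, such that $tp_{\tau_1}(i_1,\dots,i_n;EM(I,\Phi))=\Phi(tp_{\mathcal K}(i_1,\dots,i_n;I))$ for all $i_1<\dots<i_n$ in $I$, and every element of which is the value of a $\tau_1$-term at elements of $I$. For $\tau\subseteq\tau_1$, $EM_\tau(I,\Phi)$ is its reduct to $\tau$. An ordered abstract class $\mathcal K$ with a bigness notion $\mathbf g$ is an *Erdős–Rado class* if there is a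 function $f$ from cardinals to cardinals such that for every cardinal $\mu$ there is an $f(\mu)$-big member of $\mathcal K$, and for every language $\tau_1$ with $|\tau_1|\le\mu$, every $f(\mu)$-big $I\in\mathcal K$, every $\tau_1$-structure $M$ and every injection $h:I\to M$ there is a blueprint $\Phi$ proper for $\mathcal K$ with $\tau(\Phi)=\tau_1$ such that every $p\in S^{inc}_{\mathcal K}$ is realized by some $i_1<\dots<i_n$ in $I$ with $tp_{\tau_1}(h(i_1),\dots,h(i_n);M)=\Phi(p)$. For a set $T$ of $L_{\infty,\omega}(\tau)$-sentences and a set $F$ of $L_{\infty,\omega}(\tau)$-formulas, each with finitely many free variables, let $\mathrm{Mod}_F(T)$ be the category of models of $T$ with the homomorphisms preserving satisfaction of every formula in $F$ as morphisms (if $F$ is a fragment, these are the $F$-elementary embeddings). A category is *$L_{\infty,\omega}$-elementary* if it is equivalent to some $\mathrm{Mod}_F(T)$, and *large* if it is not equivalent to a small category. *Statement.* Let $\mathcal K$ be an Erdős–Rado class and let $\mathbb K$ be a large $L_{\infty,\omega}$-elementary category, with $\mathbb K\simeq\mathrm{Mod}_F(T)$, $T$ and $F$ in the language $\tau$. Then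 there are a language $\tau_1\supseteq\tau$, a blueprint $\Phi$ proper for $\mathcal K$ with $\tau(\Phi)=\tau_1$, and a functor $G:\mathcal K\to\mathrm{Mod}_F(T)$ with $G(I)=EM_\tau(I,\Phi)$ for $I\in\mathcal K$ and $G(f)\big(\sigma(i_1,\dots,i_n)\big)=\sigma(f(i_1),\dots,f(i_n))$ for $f:I\to J$ in $\mathcal K$, $i_1,\dots,i_n\in I$ and $\tau_1$-terms $\sigma$, such that the composite functor $\mathcal K\to\mathrm{Mod}_F(T)\simeq\mathbb K$ is faithful and preserves every directed colimit of $\mathcal K$ that is preserved by the underlying-set functor of $\mathcal K$ (that is, every directed colimit computed as a union). In particular, if directed colimits in $\mathcal K$ are computed on underlying sets, then it preserves directed colimits. -/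

import Mathlib

open FirstOrder CategoryTheory

universe u v w

namespace ERClass

/-! ### Abstract classes -/

/-- An abstract class of `L`-structures: a class `Mem` of structures closed under isomorphism,
and a relation `Le N S` (read: `S ≤ N` in the class) between members `N` and some of their
substructures `S`, which is a partial order contained in the substructure relation and which
respects isomorphism.  (Antisymmetry is inherited from the substructure relation.) -/
structure AbstractClass (L : FirstOrder.Language.{u, u}) where
  Mem : ∀ (M : Type u) [L.Structure M], Prop
  Le : ∀ (N : Type u) [L.Structure N], L.Substructure N → Prop
  mem_iso : ∀ (M N : Type u) [L.Structure M] [L.Structure N], (M ≃[L] N) → Mem M → Mem N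
  le_iso : ∀ (M N : Type u) [L.Structure M] [L.Structure N] (e : M ≃[L] N)
    (S : L.Substructure M), Le M S → Le N (S.map e.toHom)
  mem_left : ∀ (N : Type u) [L.Structure N] (S : L.Substructure N), Le N S → Mem S
  mem_right : ∀ (N : Type u) [L.Structure N] (S : L.Substructure N), Le N S → Mem N
  le_refl : ∀ (N : Type u) [L.Structure N], Mem N → Le N ⊤
  le_trans : ∀ (N : Type u) [L.Structure N] (S T : L.Substructure N), S ≤ T →
    Le T (S.comap T.subtype.toHom) → Le N T → Le N S

namespace AbstractClass

variable {L : FirstOrder.Language.{u, u}} (C : AbstractClass L)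

/-- The members of an abstract class. -/
structure Obj where
  carrier : Type u
  [str : L.Structure carrier]
  mem : C.Mem carrier

instance : CoeSort C.Obj (Type u) := ⟨Obj.carrier⟩

attribute [instance] Obj.str

variable {C}

/-- A `C`-embedding `M → N`: an embedding of structures whose range is `≤ N` in the class. -/
@[ext]
structure Hom (M N : C.Obj) where
  toEmbedding : M ↪[L] N
  range_le : C.Le N toEmbedding.toHom.range

theorem range_comp_le {M N P : C.Obj} (f : Hom M N) (g : Hom N P) :
    C.Le P (g.toEmbedding.comp f.toEmbedding).toHom.range := by
  have h1 := C.le_iso N g.toEmbedding.toHom.range g.toEmbedding.equivRange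
    f.toEmbedding.toHom.range f.range_le
  refine C.le_trans P _ g.toEmbedding.toHom.range ?_ ?_ g.range_le
  · rintro _ ⟨x, rfl⟩
    exact ⟨f.toEmbedding x, rfl⟩
  · convert h1 using 1
    ext y
    constructor
    · rintro ⟨x, hx⟩
      exact ⟨f.toEmbedding x, ⟨x, rfl⟩, Subtype.ext hx⟩
    · rintro ⟨_, ⟨x, rfl⟩, hx⟩
      exact ⟨x, congrArg Subtype.val hx⟩

/-- An abstract class is a category, with the `C`-embeddings as morphisms. -/
instance : Category.{u} C.Obj where
  Hom M N := Hom M N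
  id M := ⟨FirstOrder.Language.Embedding.refl L M, by
    have h : (FirstOrder.Language.Embedding.refl L M).toHom.range = ⊤ := FirstOrder.Language.Hom.range_id
    rw [h]
    exact C.le_refl M M.mem⟩
  comp f g := ⟨g.toEmbedding.comp f.toEmbedding, range_comp_le f g⟩

instance (M N : C.Obj) : CoeFun (M ⟶ N) (fun _ => M → N) := ⟨fun f => Hom.toEmbedding f⟩

variable (C)

/-- The underlying set functor. -/
def underlying : C.Obj ⥤ Type u where
  obj M := M
  map f := TypeCat.ofHom f

/-! ### Types -/

/-- `n`-tuples in members of the class. -/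
def Tuple (n : ℕ) : Type (u + 1) := Σ M : C.Obj, (Fin n → M)

/-- A tuple is related to each of its images under `C`-embeddings. -/
def Step (n : ℕ) (x y : C.Tuple n) : Prop := ∃ f : x.1 ⟶ y.1, ∀ k, f (x.2 k) = y.2 k

/-- The Stone space of `C`-types of `n`-tuples.  Two tuples have the same `C`-type iff they are
connected by a finite zigzag of `C`-embeddings, i.e. iff they are identified by the equivalence
relation generated by `Step`. -/
def TypeSpace (n : ℕ) : Type (u + 1) := Quot (C.Step n)

variable {C}

/-- The `C`-type of a tuple `a` computed in `M`. -/
def tp {n : ℕ} (M : C.Obj) (a : Fin n → M) : C.TypeSpace n := Quot.mk _ ⟨M, a⟩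

/-- The type `p^s` of the subtuple indexed by `s`. -/
def TypeSpace.restrict {m n : ℕ} (p : C.TypeSpace n) (s : Fin m ↪o Fin n) : C.TypeSpace m :=
  Quot.map (fun x : C.Tuple n => (⟨x.1, fun k => x.2 (s k)⟩ : C.Tuple m))
    (fun _ _ ⟨f, hf⟩ => ⟨f, fun k => hf (s k)⟩) p

/-- The abstract class of all `L`-structures with the substructure relation. -/
def all (L : FirstOrder.Language.{u, u}) : AbstractClass L where
  Mem _ _ := True
  Le _ _ _ := True
  mem_iso _ _ _ _ _ _ := trivial
  le_iso _ _ _ _ _ _ _ := trivial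
  mem_left _ _ _ _ := trivial
  mem_right _ _ _ _ := trivial
  le_refl _ _ _ := trivial
  le_trans _ _ _ _ _ _ _ := trivial

end AbstractClass

/-- The type `tp_L(a; M)` of a tuple in the class of all `L`-structures with substructure. -/
def tpStr (L : FirstOrder.Language.{u, u}) {n : ℕ} (M : Type u) [L.Structure M] (a : Fin n → M) :
    (AbstractClass.all L).TypeSpace n :=
  AbstractClass.tp (C := AbstractClass.all L) ⟨M, trivial⟩ a

/-! ### Ordered abstract classes, bigness notions, blueprints -/

/-- An abstract class with a distinguished binary relation symbol which is interpreted as a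
(strict) total order in every member. -/
structure OrderedAbstractClass (L : FirstOrder.Language.{u, u}) extends AbstractClass L where
  lt : L.Relations 2
  total : ∀ (M : Type u) [L.Structure M], Mem M →
    IsStrictTotalOrder M (fun a b => FirstOrder.Language.Structure.RelMap lt ![a, b])

namespace OrderedAbstractClass

variable {L : FirstOrder.Language.{u, u}} (K : OrderedAbstractClass L)

/-- The members of an ordered abstract class, as a category. -/
abbrev Obj : Type (u + 1) := K.toAbstractClass.Obj

variable {K}

/-- The tuple `a` is listed in increasing order. -/
def Increasing {n : ℕ} (I : K.Obj) (a : Fin n → I) : Prop :=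
  ∀ j k : Fin n, j < k → FirstOrder.Language.Structure.RelMap K.lt ![a j, a k]

variable (K)

/-- The space of types of increasing `n`-tuples. -/
def IncType (n : ℕ) : Type (u + 1) :=
  {p : K.TypeSpace n // ∃ (I : K.Obj) (a : Fin n → I), Increasing I a ∧ AbstractClass.tp I a = p}

variable {K}

/-- The type of an increasing tuple. -/
def incTp {n : ℕ} (I : K.Obj) (a : Fin n → I) (ha : Increasing I a) : K.IncType n :=
  ⟨AbstractClass.tp I a, I, a, ha, rfl⟩

/-- The restriction `p^s` of an increasing type. -/
def IncType.restrict {m n : ℕ} (p : K.IncType n) (s : Fin m ↪o Fin n) : K.IncType m :=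
  ⟨AbstractClass.TypeSpace.restrict p.1 s, by
    obtain ⟨_, I, a, ha, rfl⟩ := p
    exact ⟨I, fun k => a (s k), fun j k hjk => ha _ _ (s.strictMono hjk), rfl⟩⟩

variable (K)

/-- A bigness notion: `big μ I` says that `I` is `μ`-big. -/
structure Bigness where
  big : Cardinal.{u} → K.Obj → Prop
  mono : ∀ (μ₁ μ₂ : Cardinal.{u}), μ₁ ≤ μ₂ → ∀ (N : K.Obj) (S : L.Substructure N)
    (h : K.Le N S), big μ₂ ⟨S, K.mem_left N S h⟩ → big μ₁ N
  realizes : ∀ M : K.Obj, big Cardinal.aleph0 M → ∀ (n : ℕ) (p : K.TypeSpace n),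
    ∃ a : Fin n → M, AbstractClass.tp M a = p

/-- A blueprint proper for `K` in the language `τ`. -/
structure Blueprint (τ : FirstOrder.Language.{u, u}) where
  toFun : ∀ {n : ℕ}, K.IncType n → (AbstractClass.all τ).TypeSpace n
  coherent : ∀ {m n : ℕ} (p : K.IncType n) (s : Fin m ↪o Fin n),
    toFun (p.restrict s) = (toFun p).restrict s

variable {K}

/-- `K` is a `(μ, χ, g)`-Erdős–Rado class. -/
def ErdosRadoAt (g : K.Bigness) (μ χ : Cardinal.{u}) : Prop :=
  ∀ τ : FirstOrder.Language.{u, u}, τ.card ≤ μ → ∀ I : K.Obj, g.big χ I →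
    ∀ (M : Type u) [τ.Structure M] (f : I → M), Function.Injective f →
      ∃ Φ : K.Blueprint τ, ∀ (n : ℕ) (p : K.IncType n), ∃ a : Fin n → I,
        Increasing I a ∧ AbstractClass.tp I a = p.1 ∧ tpStr τ M (f ∘ a) = Φ.toFun p

/-- `K` is a `g`-Erdős–Rado class: some function `f` on cardinals witnesses the Erdős–Rado
condition at every `μ`, where `f μ`-big members do exist (so that no instance is vacuous). -/
def IsErdosRado (g : K.Bigness) : Prop :=
  ∃ f : Cardinal.{u} → Cardinal.{u}, ∀ μ : Cardinal.{u},
    (∃ I : K.Obj, g.big (f μ) I) ∧ ErdosRadoAt g μ (f μ)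

/-- The `τ`-structure `N`, with `I` sitting inside it through `ι`, is the Ehrenfeucht–Mostowski
model `EM(I, Φ)`: increasing tuples from `I` have the type prescribed by `Φ`, and every element
is the value of a `τ`-term at elements of `I`. -/
structure IsEM {τ : FirstOrder.Language.{u, u}} (Φ : K.Blueprint τ) (I : K.Obj) (N : Type u)
    [τ.Structure N] (ι : I → N) : Prop where
  injective : Function.Injective ι
  tp_eq : ∀ (n : ℕ) (a : Fin n → I) (ha : Increasing I a),
    tpStr τ N (ι ∘ a) = Φ.toFun (incTp I a ha)
  generated : ∀ x : N, ∃ (n : ℕ) (t : τ.Term (Fin n)) (a : Fin n → I), t.realize (ι ∘ a) = x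

end OrderedAbstractClass

/-! ### Infinitary logic and the categories axiomatized in it -/

/-- Formulas of `L_{∞,ω}` with free variables indexed by `Fin n` (the remaining connectives and
the universal quantifier are definable through negation). -/
inductive InfFormula (L : FirstOrder.Language.{u, u}) : ℕ → Type (u + 1)
  | equal {n : ℕ} (t₁ t₂ : L.Term (Fin n)) : InfFormula L n
  | rel {n l : ℕ} (R : L.Relations l) (ts : Fin l → L.Term (Fin n)) : InfFormula L n
  | neg {n : ℕ} (φ : InfFormula L n) : InfFormula L n
  | disj {n : ℕ} (ι : Type u) (φ : ι → InfFormula L n) : InfFormula L n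
  | ex {n : ℕ} (φ : InfFormula L (n + 1)) : InfFormula L n

/-- Satisfaction of `L_{∞,ω}`-formulas. -/
def InfFormula.Realize {L : FirstOrder.Language.{u, u}} {M : Type u} [L.Structure M] :
    ∀ {n : ℕ}, InfFormula L n → (Fin n → M) → Prop
  | _, .equal t₁ t₂, x => t₁.realize x = t₂.realize x
  | _, .rel R ts, x => FirstOrder.Language.Structure.RelMap R (fun k => (ts k).realize x)
  | _, .neg φ, x => ¬ φ.Realize x
  | _, .disj ι φ, x => ∃ k : ι, (φ k).Realize x
  | _, .ex φ, x => ∃ y : M, φ.Realize (Fin.snoc x y : Fin _ → M)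

/-- Models of a set `T` of `L_{∞,ω}`-sentences; the parameter `F` only determines the
morphisms. -/
structure ModCat {L : FirstOrder.Language.{u, u}} (T : Set (InfFormula L 0))
    (F : Set (Σ n : ℕ, InfFormula L n)) where
  carrier : Type u
  [str : L.Structure carrier]
  models : ∀ φ ∈ T, φ.Realize (Fin.elim0 : Fin 0 → carrier)

namespace ModCat

variable {L : FirstOrder.Language.{u, u}} {T : Set (InfFormula L 0)} {F : Set (Σ n : ℕ, InfFormula L n)}

instance : CoeSort (ModCat T F) (Type u) := ⟨ModCat.carrier⟩

attribute [instance] ModCat.str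

/-- Homomorphisms that preserve every formula in `F`.  If `F` is a fragment of `L_{∞,ω}` these
are the `F`-elementary embeddings; if `F` consists of the negated atomic formulas, they are the
embeddings; if `F` is empty, they are all homomorphisms. -/
@[ext]
structure Hom (M N : ModCat T F) where
  toHom : M →[L] N
  preserves : ∀ (n : ℕ) (φ : InfFormula L n), (⟨n, φ⟩ : Σ n : ℕ, InfFormula L n) ∈ F →
    ∀ x : Fin n → M, φ.Realize x → φ.Realize (toHom ∘ x)

instance : Category.{u} (ModCat T F) where
  Hom M N := Hom M N
  id M := ⟨FirstOrder.Language.Hom.id L M, fun _ _ _ _ h => h⟩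
  comp f g := ⟨g.toHom.comp f.toHom, fun n φ hφ x h =>
    g.preserves n φ hφ _ (f.preserves n φ hφ x h)⟩

instance (M N : ModCat T F) : CoeFun (M ⟶ N) (fun _ => M → N) := ⟨fun f => Hom.toHom f⟩

end ModCat

/-- A presentation of a category `𝕂` as an `L_{∞,ω}`-elementary category: an equivalence with
the category of models of a (small) set of `L_{∞,ω}`-sentences in a (small) language `τ`, with
the morphisms given by some (small) set of `L_{∞,ω}`-formulas. -/
structure ElementaryPresentation (𝕂 : Type w) [Category.{v} 𝕂] (τ : FirstOrder.Language.{u, u}) where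
  T : Set (InfFormula τ 0)
  F : Set (Σ n : ℕ, InfFormula τ n)
  small_T : Small.{u} T
  small_F : Small.{u} F
  equiv : ModCat T F ≌ 𝕂

/-- A category is large if it is not equivalent to a small category. -/
def IsLarge (𝕂 : Type w) [Category.{v} 𝕂] : Prop := ¬ EssentiallySmall.{u} 𝕂

/-- The functor `G` is `I ↦ EM_τ(I, Φ)`: each `G(I)` is the reduct to `τ` of the Ehrenfeucht–
Mostowski model `EM(I, Φ)`, and `G(f)` sends `σ(i₁, …, iₙ)` to `σ(f i₁, …, f iₙ)` for each
`τ(Φ)`-term `σ`. -/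
def IsEMFunctor {L τ τ₁ : FirstOrder.Language.{u, u}} {K : OrderedAbstractClass L} {T : Set (InfFormula τ 0)}
    {F : Set (Σ n : ℕ, InfFormula τ n)} (j : τ →ᴸ τ₁) (Φ : K.Blueprint τ₁)
    (G : K.Obj ⥤ ModCat T F) : Prop :=
  ∃ (_ : ∀ I : K.Obj, τ₁.Structure (G.obj I)) (ι : ∀ I : K.Obj, I → G.obj I),
    (∀ I : K.Obj, j.IsExpansionOn (G.obj I) ∧ K.IsEM Φ I (G.obj I) (ι I)) ∧
    ∀ (I J : K.Obj) (f : I ⟶ J) (n : ℕ) (σ : τ₁.Term (Fin n)) (a : Fin n → I),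
      G.map f (σ.realize (fun k => ι I (a k))) = σ.realize (fun k => ι J (f (a k)))

end ERClass

/-! Models of bounded cardinality form an essentially small category, so largeness supplies a model
`M` of `T` into which any prescribed member `I₀` of the class injects. Fix a small subformula-closed
set `S` of formulas containing `T` and `F`, and expand `M` by a relation symbol and a Skolem
function for each formula in `S`. Applied to this expansion and a sufficiently big `I₀`, the
Erdős–Rado property yields a blueprint `Φ` whose types are all realized in `M` by images of
increasing tuples of `I₀`.

Compactness fails for infinitary logic, but it is not needed: every finite tuple of `EM(I, Φ)`
consists of values of terms at one increasing tuple, so its quantifier-free type is already realized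
in `M` (`IsEM.exists_sameAtomicType`). This suffices for the new relation symbols to mean the
formulas they name (`SubformulaClosed.relMap_iff_realize`). Infinite disjunctions cause no trouble,
since all disjuncts are tested on the same tuple of `M`, and existential witnesses come from Skolem
terms. Hence `EM(I, Φ)` is a model of `T`, and embeddings in the expanded language preserve and
reflect `F`.

A morphism `I ⟶ J` preserves types of increasing tuples, so it extends uniquely to values of terms,
giving a functor. It is faithful because `I` sits injectively in its model. It preserves colimits
computed as unions because each element depends on finitely many elements of `I`. -/

namespace ERClass

open FirstOrder.Language FirstOrder.Language.Structure

/-! ### Quantifier-free types -/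

section AtomicType

variable (L : FirstOrder.Language.{u, u}) {α β M N P : Type*} [L.Structure M] [L.Structure N]
  [L.Structure P]

/-- Two families satisfy the same atomic formulas (equivalently, the same quantifier-free ones). -/
structure SameAtomicType (x : α → M) (y : α → N) : Prop where
  eq_iff : ∀ t s : L.Term α, t.realize x = s.realize x ↔ t.realize y = s.realize y
  rel_iff : ∀ {l : ℕ} (R : L.Relations l) (ts : Fin l → L.Term α),
    RelMap R (fun k => (ts k).realize x) ↔ RelMap R (fun k => (ts k).realize y)

variable {L}

namespace SameAtomicType

theorem refl (x : α → M) : SameAtomicType L x x := ⟨fun _ _ => Iff.rfl, fun _ _ => Iff.rfl⟩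

variable {x : α → M} {y : α → N} {z : α → P}

theorem symm (h : SameAtomicType L x y) : SameAtomicType L y x :=
  ⟨fun t s => (h.eq_iff t s).symm, fun R ts => (h.rel_iff R ts).symm⟩

theorem trans (h : SameAtomicType L x y) (h' : SameAtomicType L y z) : SameAtomicType L x z :=
  ⟨fun t s => (h.eq_iff t s).trans (h'.eq_iff t s),
    fun R ts => (h.rel_iff R ts).trans (h'.rel_iff R ts)⟩

/-- Families of values of the same terms at families of the same type have the same type. -/
theorem subst (h : SameAtomicType L x y) (tf : β → L.Term α) :
    SameAtomicType L (fun b => (tf b).realize x) (fun b => (tf b).realize y) :=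
  ⟨fun t s => by simpa only [Term.realize_subst] using h.eq_iff (t.subst tf) (s.subst tf),
    fun R ts => by simpa only [Term.realize_subst] using h.rel_iff R (fun k => (ts k).subst tf)⟩

theorem comp (h : SameAtomicType L x y) (c : β → α) : SameAtomicType L (x ∘ c) (y ∘ c) :=
  h.subst (fun b => Term.var (c b))

theorem of_embedding (e : M ↪[L] N) (x : α → M) : SameAtomicType L x (e ∘ x) := by
  refine ⟨fun t s => ?_, fun R ts => ?_⟩
  · rw [HomClass.realize_term, HomClass.realize_term, e.injective.eq_iff]
  · simp only [HomClass.realize_term]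
    exact (e.map_rel R (fun k => (ts k).realize x)).symm

/-- If `x` generates `M`, then a family with the same type as `x` induces an embedding of `M`. -/
theorem exists_embedding (h : SameAtomicType L x y) (gen : ∀ m : M, ∃ t : L.Term α, t.realize x = m) :
    ∃ e : M ↪[L] N, ∀ t : L.Term α, e (t.realize x) = t.realize y := by
  choose t ht using gen
  -- The value at `y` does not depend on the term chosen to name an element, so the induced map is
  -- canonical.
  have key : ∀ s : L.Term α, (t (s.realize x)).realize y = s.realize y := fun s =>
    (h.eq_iff _ _).1 (ht _)
  refine ⟨⟨⟨fun m => (t m).realize y, fun m m' hm => ?_⟩, fun {n} f m => ?_, fun {n} R m => ?_⟩, key⟩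
  · rw [← ht m, ← ht m']
    exact (h.eq_iff _ _).2 hm
  · have := key (Term.func f (fun k => t (m k)))
    simp only [Term.realize_func, ht] at this
    exact this
  · have := h.rel_iff R (fun k => t (m k))
    simp only [ht] at this
    exact this.symm

/-- Sameness of types is tested on any supply of families through which all finite subfamilies
factor. -/
theorem of_comp {ι : Type*} {κ : ι → Type*} (a : ∀ i, κ i → α)
    (cover : ∀ s : Finset α, ∃ i, ↑s ⊆ Set.range (a i))
    (h : ∀ i, SameAtomicType L (x ∘ a i) (y ∘ a i)) : SameAtomicType L x y := by
  classical
  -- A term has finitely many variables, so it already lives over a single family `a i`.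
  have lift : ∀ (t : L.Term α) (i : ι), ↑t.varFinset ⊆ Set.range (a i) →
      ∃ t' : L.Term (κ i), t = t'.relabel (a i) := by
    intro t i
    induction t with
    | var k =>
      intro hk
      obtain ⟨c, rfl⟩ := hk (by simp [Term.varFinset] : k ∈ _)
      exact ⟨Term.var c, rfl⟩
    | func f ts ih =>
      intro hk
      have : ∀ k, ∃ t' : L.Term (κ i), ts k = t'.relabel (a i) := fun k => ih k fun z hz =>
        hk (by
          simp only [Term.varFinset, Finset.coe_biUnion, Set.mem_iUnion]
          exact ⟨k, by simp, hz⟩)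
      choose t' ht' using this
      exact ⟨Term.func f t', by simp only [Term.relabel]; congr 1; exact funext ht'⟩
  refine ⟨fun t s => ?_, fun {l} R ts => ?_⟩
  · obtain ⟨i, hi⟩ := cover (t.varFinset ∪ s.varFinset)
    rw [Finset.coe_union, Set.union_subset_iff] at hi
    obtain ⟨t', rfl⟩ := lift t i hi.1
    obtain ⟨s', rfl⟩ := lift s i hi.2
    simpa only [Term.realize_relabel] using (h i).eq_iff t' s'
  · obtain ⟨i, hi⟩ := cover (Finset.univ.biUnion fun k => (ts k).varFinset)
    have : ∀ k, ∃ t' : L.Term (κ i), ts k = t'.relabel (a i) := fun k => lift (ts k) i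
      (Set.Subset.trans (Finset.coe_subset.2
        (Finset.subset_biUnion_of_mem (fun k => (ts k).varFinset) (Finset.mem_univ k))) hi)
    choose t' ht' using this
    simpa only [ht', Term.realize_relabel] using (h i).rel_iff R t'

end SameAtomicType

/-- A zigzag of embeddings preserves atomic formulas. Conversely, two links suffice: the
substructure generated by `a` includes into `M`, and it embeds into `N` by sending values of terms
at `a` to their values at `b`. -/
theorem tpStr_eq_iff {M N : Type u} [L.Structure M] [L.Structure N] {n : ℕ} {a : Fin n → M}
    {b : Fin n → N} : tpStr L M a = tpStr L N b ↔ SameAtomicType L a b := by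
  constructor
  · intro h
    have h' := Quot.eqvGen_exact h
    have : ∀ p q : (AbstractClass.all L).Tuple n,
        Relation.EqvGen ((AbstractClass.all L).Step n) p q → SameAtomicType L p.2 q.2 := by
      intro p q hpq
      induction hpq with
      | rel p q hpq =>
        obtain ⟨f, hf⟩ := hpq
        rw [← (funext hf : (f.toEmbedding ∘ p.2) = q.2)]
        exact SameAtomicType.of_embedding f.toEmbedding p.2
      | refl p => exact SameAtomicType.refl _
      | symm _ _ _ ih => exact ih.symm
      | trans _ _ _ _ _ ih ih' => exact ih.trans ih'
    exact this _ _ h'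
  · intro h
    let S : L.Substructure M := Substructure.closure L (Set.range a)
    let c : Fin n → S := fun k => ⟨a k, Substructure.subset_closure ⟨k, rfl⟩⟩
    have hc : SameAtomicType L c b := (SameAtomicType.of_embedding S.subtype c).trans h
    have gen : ∀ m : S, ∃ t : L.Term (Fin n), t.realize c = m := by
      rintro ⟨m, hm⟩
      obtain ⟨t, rfl⟩ := Substructure.mem_closure_iff_exists_term.1 hm
      have hi : ∀ i : Set.range a, ∃ k, a k = i := fun i => i.2
      choose k hk using hi
      refine ⟨t.relabel k, Subtype.ext ?_⟩
      rw [Term.realize_relabel]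
      have : S.subtype ((t.realize (c ∘ k)) : S) = t.realize (S.subtype ∘ (c ∘ k)) :=
        (HomClass.realize_term S.subtype).symm
      refine this.trans (congrArg (fun v => t.realize v) (funext hk))
    obtain ⟨e, he⟩ := hc.exists_embedding gen
    have h₁ : tpStr L S c = tpStr L M a := Quot.sound ⟨⟨S.subtype, trivial⟩, fun _ => rfl⟩
    have h₂ : tpStr L S c = tpStr L N b :=
      Quot.sound ⟨⟨e, trivial⟩, fun k => he (Term.var k)⟩
    exact h₁.symm.trans h₂

end AtomicType

/-! ### Ehrenfeucht–Mostowski models -/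

namespace OrderedAbstractClass

variable {L : FirstOrder.Language.{u, u}} {K : OrderedAbstractClass L}

theorem Increasing.map {n : ℕ} {I J : K.Obj} {a : Fin n → I} (ha : Increasing I a) (f : I ⟶ J) :
    Increasing J (f ∘ a) := fun j k hjk => by
  have h := (f.toEmbedding.map_rel K.lt ![a j, a k]).2 (ha j k hjk)
  have : f.toEmbedding ∘ ![a j, a k] = ![(f ∘ a) j, (f ∘ a) k] := by
    funext i; fin_cases i <;> rfl
  rwa [this] at h

theorem Increasing.injective {n : ℕ} {I : K.Obj} {a : Fin n → I} (ha : Increasing I a) :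
    Function.Injective a := by
  have := K.total I I.mem
  intro j k hjk
  by_contra hne
  rcases lt_or_gt_of_ne hne with h | h
  · exact irrefl_of (fun a b : I => RelMap K.lt ![a, b]) (a j) (by simpa [hjk] using ha _ _ h)
  · exact irrefl_of (fun a b : I => RelMap K.lt ![a, b]) (a j) (by simpa [hjk] using ha _ _ h)

theorem exists_increasing (I : K.Obj) (s : Finset I) :
    ∃ (n : ℕ) (a : Fin n → I), Increasing I a ∧ Set.range a = s := by
  classical
  have := K.total I I.mem
  let : LinearOrder I := linearOrderOfSTO (fun a b : I => RelMap K.lt ![a, b])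
  exact ⟨s.card, s.orderEmbOfFin rfl, fun j k hjk => (s.orderEmbOfFin rfl).strictMono hjk,
    s.range_orderEmbOfFin rfl⟩

/-- An increasing tuple with entries among those of another one is a subtuple of it. -/
theorem Increasing.exists_orderEmbedding {m n : ℕ} {I : K.Obj} {a : Fin m → I} {b : Fin n → I}
    (ha : Increasing I a) (hb : Increasing I b) (h : Set.range a ⊆ Set.range b) :
    ∃ s : Fin m ↪o Fin n, a = b ∘ s := by
  have := K.total I I.mem
  choose s hs using fun k => h ⟨k, rfl⟩
  refine ⟨OrderEmbedding.ofStrictMono s fun j k hjk => ?_, funext fun k => (hs k).symm⟩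
  by_contra hle
  have hjk' := ha j k hjk
  rw [← hs j, ← hs k] at hjk'
  rcases (not_lt.1 hle).lt_or_eq with hlt | heq
  · exact asymm_of (fun a b : I => RelMap K.lt ![a, b]) hjk' (hb _ _ hlt)
  · rw [heq] at hjk'
    exact irrefl_of (fun a b : I => RelMap K.lt ![a, b]) _ hjk'

theorem incTp_map {n : ℕ} {I J : K.Obj} {a : Fin n → I} (ha : Increasing I a) (f : I ⟶ J) :
    incTp J (f ∘ a) (ha.map f) = incTp I a ha :=
  Subtype.ext (Quot.sound (⟨f, fun _ => rfl⟩ : K.Step n ⟨I, a⟩ ⟨J, f ∘ a⟩)).symm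

variable {τ : FirstOrder.Language.{u, u}} {Φ : K.Blueprint τ}

/-- The types prescribed by `Φ` are realized in `M` by `h`-images of increasing tuples of `I₀`. -/
def Blueprint.RealizedBy (Φ : K.Blueprint τ) {I₀ : K.Obj} {M : Type u} [τ.Structure M]
    (h : I₀ → M) : Prop :=
  ∀ (n : ℕ) (p : K.IncType n), ∃ a : Fin n → I₀,
    Increasing I₀ a ∧ AbstractClass.tp I₀ a = p.1 ∧ tpStr τ M (h ∘ a) = Φ.toFun p

/-- `f` preserves the class type of increasing tuples, and `Φ` sees nothing else; increasing tuples
exhaust all finite subsets of `I`. -/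
theorem IsEM.sameAtomicType_map {I J : K.Obj} {N N' : Type u} [τ.Structure N] [τ.Structure N']
    {ι : I → N} {ι' : J → N'} (h : K.IsEM Φ I N ι) (h' : K.IsEM Φ J N' ι') (f : I ⟶ J) :
    SameAtomicType τ ι (ι' ∘ f) := by
  refine SameAtomicType.of_comp
    (ι := {p : Σ n : ℕ, (Fin n → I) // Increasing I p.2}) (fun p => p.1.2) (fun s => ?_) ?_
  · obtain ⟨n, a, ha, hs⟩ := exists_increasing I s
    exact ⟨⟨⟨n, a⟩, ha⟩, hs.ge⟩
  · rintro ⟨⟨n, a⟩, ha⟩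
    refine tpStr_eq_iff.1 ((h.tp_eq n a ha).trans ?_)
    rw [← incTp_map ha f]
    exact (h'.tp_eq n (f ∘ a) (ha.map f)).symm

theorem IsEM.exists_term {I : K.Obj} {N : Type u} [τ.Structure N] {ι : I → N}
    (h : K.IsEM Φ I N ι) (x : N) : ∃ t : τ.Term I, t.realize ι = x := by
  obtain ⟨n, t, a, rfl⟩ := h.generated x
  exact ⟨t.relabel a, Term.realize_relabel⟩

/-- A finite tuple of an Ehrenfeucht–Mostowski model consists of values of terms at a single
increasing tuple. -/
theorem IsEM.exists_increasing_terms {I : K.Obj} {N : Type u} [τ.Structure N] {ι : I → N}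
    (h : K.IsEM Φ I N ι) {m : ℕ} (x : Fin m → N) :
    ∃ (n : ℕ) (a : Fin n → I) (t : Fin m → τ.Term (Fin n)),
      Increasing I a ∧ ∀ k, x k = (t k).realize (ι ∘ a) := by
  classical
  choose l t b hb using fun k => h.generated (x k)
  obtain ⟨n, a, ha, hs⟩ := exists_increasing I
    (Finset.univ.biUnion fun k => Finset.univ.image (b k))
  have : ∀ k i, ∃ c, a c = b k i := fun k i => by
    change b k i ∈ Set.range a
    rw [hs]
    simp only [Finset.coe_biUnion, Set.mem_iUnion]
    exact ⟨k, by simp, by simp⟩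
  choose c hc using this
  refine ⟨n, a, fun k => (t k).relabel (c k), ha, fun k => ?_⟩
  rw [Term.realize_relabel, ← hb k]
  exact congrArg (fun v => (t k).realize v) (funext fun i => congrArg ι (hc k i).symm)

/-- Finite tuples of an Ehrenfeucht–Mostowski model have the types of tuples of the structure from
which the blueprint was read off. -/
theorem IsEM.exists_sameAtomicType {I₀ I : K.Obj} {M N : Type u} [τ.Structure M] [τ.Structure N]
    {g : I₀ → M} (hΦ : Φ.RealizedBy g) {ι : I → N} (h : K.IsEM Φ I N ι) {m : ℕ} (x : Fin m → N) :
    ∃ y : Fin m → M, SameAtomicType τ x y := by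
  obtain ⟨n, a, t, ha, hx⟩ := h.exists_increasing_terms x
  obtain ⟨b, -, -, hb⟩ := hΦ n (incTp I a ha)
  obtain rfl := funext hx
  exact ⟨_, (tpStr_eq_iff.1 ((h.tp_eq n a ha).trans hb.symm)).subst t⟩

open Filter in
/-- Ehrenfeucht–Mostowski models exist over every member of the class: they are generated by a
copy of `I` in an ultrapower of `M`. -/
theorem Blueprint.RealizedBy.exists_isEM {I₀ : K.Obj} {M : Type u} [τ.Structure M] [Nonempty M]
    {g : I₀ → M} (hg : Function.Injective g) (hΦ : Φ.RealizedBy g) (I : K.Obj) :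
    ∃ (N : Type u) (_ : τ.Structure N) (ι : I → N), K.IsEM Φ I N ι := by
  classical
  -- Over a finite part `s` of `I`, the prescribed types are realized in `M` itself: realize the
  -- type of the increasing enumeration of `s`; coherence of `Φ` handles all its subtuples. Values
  -- outside `s` are arbitrary.
  have val : ∀ s : Finset I, ∃ r : I → M, ∀ (n : ℕ) (a : Fin n → I) (ha : Increasing I a),
      Set.range a ⊆ s → tpStr τ M (r ∘ a) = Φ.toFun (incTp I a ha) := by
    intro s
    obtain ⟨m, b, hb, hs⟩ := exists_increasing I s
    obtain ⟨c, -, -, hc⟩ := hΦ m (incTp I b hb)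
    refine ⟨Function.extend b (g ∘ c) (fun _ => Classical.arbitrary M), fun n a ha has => ?_⟩
    obtain ⟨e, rfl⟩ := ha.exists_orderEmbedding hb (has.trans hs.ge)
    have h₁ := Φ.coherent (incTp I b hb) e
    rw [← hc] at h₁
    have h₂ : Function.extend b (g ∘ c) (fun _ => Classical.arbitrary M) ∘ b ∘ e = (g ∘ c) ∘ e :=
      funext fun k => hb.injective.extend_apply _ _ _
    rw [h₂]
    exact h₁.symm
  choose r hr using val
  -- Every tail `{s | s₀ ⊆ s}` belongs to `U`, so each increasing tuple is eventually covered by `s`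
  -- and assigned its prescribed type. Łoś's theorem then gives `ι₀` these types.
  let U : Ultrafilter (Finset I) := Ultrafilter.of atTop
  let P : Type u := (U : Filter (Finset I)).Product (fun _ => M)
  let ι₀ : I → P := fun i => ((fun s => r s i : Finset I → M) : P)
  have type₀ : ∀ (n : ℕ) (a : Fin n → I) (ha : Increasing I a) (b : Fin n → M),
      tpStr τ M b = Φ.toFun (incTp I a ha) → SameAtomicType τ (ι₀ ∘ a) b := by
    intro n a ha b hb
    have hev : ∀ᶠ s in (U : Filter (Finset I)), SameAtomicType τ (r s ∘ a) b := by
      refine Ultrafilter.of_le atTop ?_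
      filter_upwards [eventually_ge_atTop (Finset.univ.image a)] with s hs
      refine tpStr_eq_iff.1 ((hr s n a ha ?_).trans hb.symm)
      rintro _ ⟨k, rfl⟩
      exact hs (by simp)
    have hform : ∀ (φ : τ.Formula (Fin n)) (p : Prop),
        (∀ᶠ s in (U : Filter (Finset I)), (φ.Realize (r s ∘ a) ↔ p)) →
          (φ.Realize (ι₀ ∘ a) ↔ p) := by
      intro φ p hp
      refine (Ultraproduct.realize_formula_cast (u := U) (M := fun _ => M) φ
        (fun k s => r s (a k))).trans ?_
      change (∀ᶠ s in (U : Filter (Finset I)), φ.Realize (r s ∘ a)) ↔ p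
      rw [eventually_congr hp, eventually_const]
    refine ⟨fun t s => ?_, fun {l} R ts => ?_⟩
    · have := hform (t.equal s) (t.realize b = s.realize b)
        (hev.mono fun _ h => Formula.realize_equal.trans (h.eq_iff t s))
      exact Formula.realize_equal.symm.trans this
    · have := hform (R.formula ts) (RelMap R fun k => (ts k).realize b)
        (hev.mono fun _ h => Formula.realize_rel.trans (h.rel_iff R ts))
      exact Formula.realize_rel.symm.trans this
  -- Passing to the generated substructure keeps the quantifier-free types and makes every element
  -- the value of a term.
  let S : τ.Substructure P := Substructure.closure τ (Set.range ι₀)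
  let ι : I → S := fun i => ⟨ι₀ i, Substructure.subset_closure ⟨i, rfl⟩⟩
  have type : ∀ (n : ℕ) (a : Fin n → I) (ha : Increasing I a) (b : Fin n → M),
      tpStr τ M b = Φ.toFun (incTp I a ha) → SameAtomicType τ (ι ∘ a) b :=
    fun n a ha b hb => (SameAtomicType.of_embedding S.subtype (ι ∘ a)).trans (type₀ n a ha b hb)
  refine ⟨S, inferInstance, ι, fun i j hij => ?_, fun n a ha => ?_, ?_⟩
  -- Injectivity is read off from the type: an equality between entries of `ι ∘ a` would hold for
  -- the realizing tuple in `M`, contradicting injectivity of `g` and of increasing tuples.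
  · obtain ⟨n, a, ha, hs⟩ := exists_increasing I {i, j}
    obtain ⟨b, hb, -, hb'⟩ := hΦ n (incTp I a ha)
    obtain ⟨k, rfl⟩ : i ∈ Set.range a := by simp [hs]
    obtain ⟨l, rfl⟩ : j ∈ Set.range a := by simp [hs]
    have := ((type n a ha _ hb').eq_iff (Term.var k) (Term.var l)).1 hij
    rw [hb.injective (hg this)]
  · obtain ⟨b, -, -, hb⟩ := hΦ n (incTp I a ha)
    exact (tpStr_eq_iff.2 (type n a ha _ hb)).trans hb
  · rintro ⟨x, hx⟩
    obtain ⟨t, rfl⟩ := Substructure.mem_closure_iff_exists_term.1 hx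
    choose i hi using fun z : Set.range ι₀ => z.2
    let f : Fin t.varFinset.card → I := fun k => i (t.varFinset.equivFin.symm k)
    refine ⟨_, t.restrictVar t.varFinset.equivFin, f, Subtype.ext ?_⟩
    refine (HomClass.realize_term S.subtype).symm.trans ?_
    exact Term.realize_restrictVar (fun z : Set.range ι₀ => (z : P))
      (fun z => by simp [f, ι, hi])

end OrderedAbstractClass

/-! ### Subformulas and Skolem expansions -/

namespace InfFormula

variable {τ : FirstOrder.Language.{u, u}}

/-- The set of subformulas of a formula. -/
def subformulas : ∀ {n : ℕ}, InfFormula τ n → Set (Σ n : ℕ, InfFormula τ n)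
  | _, .equal t₁ t₂ => {⟨_, .equal t₁ t₂⟩}
  | _, .rel R ts => {⟨_, .rel R ts⟩}
  | _, .neg φ => insert ⟨_, .neg φ⟩ φ.subformulas
  | _, .disj ι φ => insert ⟨_, .disj ι φ⟩ (⋃ k : ι, (φ k).subformulas)
  | _, .ex φ => insert ⟨_, .ex φ⟩ φ.subformulas

theorem mem_subformulas_self {n : ℕ} (φ : InfFormula τ n) :
    (⟨n, φ⟩ : Σ n : ℕ, InfFormula τ n) ∈ φ.subformulas := by
  cases φ <;> simp [subformulas]

/-- Formulas form a type in universe `u + 1`, but disjunctions are indexed in `Type u`, so one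
formula has only a small set of subformulas. This allows them to be named by symbols of a language
in universe `u`. -/
instance small_subformulas {n : ℕ} (φ : InfFormula τ n) : Small.{u} φ.subformulas := by
  induction φ with
  | equal t₁ t₂ => rw [subformulas]; infer_instance
  | rel R ts => rw [subformulas]; infer_instance
  | neg φ ih => rw [subformulas]; infer_instance
  | disj ι φ ih => rw [subformulas]; infer_instance
  | ex φ ih => rw [subformulas]; infer_instance

end InfFormula

/-- A set of formulas which contains the immediate subformulas of its members. -/
structure SubformulaClosed {τ : FirstOrder.Language.{u, u}} (S : Set (Σ n : ℕ, InfFormula τ n)) :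
    Prop where
  neg : ∀ {n : ℕ} {φ : InfFormula τ n}, ⟨n, .neg φ⟩ ∈ S → ⟨n, φ⟩ ∈ S
  disj : ∀ {n : ℕ} {ι : Type u} {φ : ι → InfFormula τ n}, ⟨n, .disj ι φ⟩ ∈ S → ∀ k, ⟨n, φ k⟩ ∈ S
  ex : ∀ {n : ℕ} {φ : InfFormula τ (n + 1)}, ⟨n, .ex φ⟩ ∈ S → ⟨n + 1, φ⟩ ∈ S

section Skolem

variable {τ : FirstOrder.Language.{u, u}} {S : Set (Σ n : ℕ, InfFormula τ n)}

theorem SubformulaClosed.iUnion {α : Type*} {S : α → Set (Σ n : ℕ, InfFormula τ n)}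
    (h : ∀ i, SubformulaClosed (S i)) : SubformulaClosed (⋃ i, S i) := by
  refine ⟨fun hφ => ?_, fun hφ k => ?_, fun hφ => ?_⟩ <;>
    obtain ⟨i, hi⟩ := Set.mem_iUnion.1 hφ
  · exact Set.mem_iUnion.2 ⟨i, (h i).neg hi⟩
  · exact Set.mem_iUnion.2 ⟨i, (h i).disj hi k⟩
  · exact Set.mem_iUnion.2 ⟨i, (h i).ex hi⟩

theorem InfFormula.subformulaClosed_subformulas {n : ℕ} (φ : InfFormula τ n) :
    SubformulaClosed φ.subformulas := by
  induction φ with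
  | equal t₁ t₂ =>
    refine ⟨fun h => ?_, fun h => ?_, fun h => ?_⟩ <;> rw [subformulas] at h <;> cases h
  | rel R ts =>
    refine ⟨fun h => ?_, fun h => ?_, fun h => ?_⟩ <;> rw [subformulas] at h <;> cases h
  | neg φ ih =>
    refine ⟨fun h => ?_, fun h k => ?_, fun h => ?_⟩ <;> rw [subformulas] at h ⊢ <;> right <;>
      rcases h with h | h
    · cases h
      exact φ.mem_subformulas_self
    · exact ih.neg h
    · cases h
    · exact ih.disj h _
    · cases h
    · exact ih.ex h
  | disj ι φ ih =>
    have ih := SubformulaClosed.iUnion ih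
    refine ⟨fun h => ?_, fun h k => ?_, fun h => ?_⟩ <;> rw [subformulas] at h ⊢ <;> right <;>
      rcases h with h | h
    · cases h
    · exact ih.neg h
    · cases h
      exact Set.mem_iUnion.2 ⟨_, (φ _).mem_subformulas_self⟩
    · exact ih.disj h _
    · cases h
    · exact ih.ex h
  | ex φ ih =>
    refine ⟨fun h => ?_, fun h k => ?_, fun h => ?_⟩ <;> rw [subformulas] at h ⊢ <;> right <;>
      rcases h with h | h
    · cases h
    · exact ih.neg h
    · cases h
    · exact ih.disj h _
    · cases h
      exact φ.mem_subformulas_self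
    · exact ih.ex h

theorem exists_subformulaClosed (A : Set (Σ n : ℕ, InfFormula τ n)) [Small.{u} A] :
    ∃ S : Set (Σ n : ℕ, InfFormula τ n), A ⊆ S ∧ Small.{u} S ∧ SubformulaClosed S :=
  ⟨⋃ x : A, x.1.2.subformulas,
    fun x hx => Set.mem_iUnion.2 ⟨⟨x, hx⟩, x.2.mem_subformulas_self⟩, inferInstance,
    SubformulaClosed.iUnion fun _ => InfFormula.subformulaClosed_subformulas _⟩

variable (S) [Small.{u} S]

instance small_formulas_of_arity (n : ℕ) :
    Small.{u} {φ : InfFormula τ n // (⟨n, φ⟩ : Σ n : ℕ, InfFormula τ n) ∈ S} :=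
  small_of_injective (β := S) (f := fun φ => ⟨⟨n, φ.1⟩, φ.2⟩) fun φ ψ h => by
    have := congrArg Subtype.val h
    exact Subtype.ext (eq_of_heq (Sigma.mk.inj this).2)

/-- A relation symbol for each formula in `S` and a Skolem function symbol for the last variable
of each formula in `S`. -/
def skolemSymbols : FirstOrder.Language.{u, u} where
  Functions n := Shrink.{u} {φ : InfFormula τ (n + 1) // (⟨n + 1, φ⟩ : Σ n, InfFormula τ n) ∈ S}
  Relations n := Shrink.{u} {φ : InfFormula τ n // (⟨n, φ⟩ : Σ n, InfFormula τ n) ∈ S}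

/-- The intended interpretation of the symbols for the formulas in `S`. -/
noncomputable instance skolemStructure (M : Type u) [τ.Structure M] [Nonempty M] :
    (skolemSymbols S).Structure M where
  -- `epsilon` returns a witness if there is one and an arbitrary element otherwise, hence the
  -- nonemptiness assumption.
  funMap f x := Classical.epsilon fun y =>
    ((equivShrink _).symm f).1.Realize (Fin.snoc x y : Fin _ → M)
  RelMap R x := ((equivShrink _).symm R).1.Realize x

/-- The expansion of a language by relation and Skolem function symbols for the formulas in `S`. -/
abbrev skolemLanguage : FirstOrder.Language.{u, u} := τ.sum (skolemSymbols S)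

variable {S}

theorem relMap_skolemStructure {M : Type u} [τ.Structure M] [Nonempty M] {n : ℕ}
    (φ : InfFormula τ n) (hφ : (⟨n, φ⟩ : Σ n, InfFormula τ n) ∈ S) (y : Fin n → M) :
    RelMap (L := skolemSymbols S) (equivShrink _ ⟨φ, hφ⟩) y ↔ φ.Realize y :=
  iff_of_eq (congrArg (fun ψ : {φ : InfFormula τ n // (⟨n, φ⟩ : Σ n, InfFormula τ n) ∈ S} =>
    ψ.1.Realize y) (Equiv.symm_apply_apply (equivShrink _) ⟨φ, hφ⟩))

theorem realize_funMap_skolemStructure {M : Type u} [τ.Structure M] [Nonempty M] {n : ℕ}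
    (φ : InfFormula τ (n + 1)) (hφ : (⟨n + 1, φ⟩ : Σ n, InfFormula τ n) ∈ S) (y : Fin n → M)
    (h : ∃ z : M, φ.Realize (Fin.snoc y z : Fin _ → M)) :
    φ.Realize (Fin.snoc y (funMap (L := skolemSymbols S) (equivShrink _ ⟨φ, hφ⟩) y) :
      Fin _ → M) := by
  have : funMap (L := skolemSymbols S) (equivShrink _ ⟨φ, hφ⟩) y =
      Classical.epsilon fun z => φ.Realize (Fin.snoc y z : Fin _ → M) :=
    congrArg (fun ψ : {φ : InfFormula τ (n + 1) // (⟨n + 1, φ⟩ : Σ n, InfFormula τ n) ∈ S} =>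
      Classical.epsilon fun z => ψ.1.Realize (Fin.snoc y z : Fin _ → M))
      (Equiv.symm_apply_apply (equivShrink _) ⟨φ, hφ⟩)
  rw [this]
  exact Classical.epsilon_spec h

/-- In a structure which realizes only quantifier-free types of tuples of a Skolem expansion, the
relation symbols are interpreted as the formulas they stand for. -/
theorem SubformulaClosed.relMap_iff_realize (hS : SubformulaClosed S) (M : Type u) [τ.Structure M]
    [Nonempty M] (N : Type u)
    [τ.Structure N] [(skolemLanguage S).Structure N]
    [(LHom.sumInl : τ →ᴸ skolemLanguage S).IsExpansionOn N]
    (hN : ∀ (m : ℕ) (x : Fin m → N), ∃ y : Fin m → M, SameAtomicType (skolemLanguage S) x y)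
    {n : ℕ} (φ : InfFormula τ n) (hφ : (⟨n, φ⟩ : Σ n, InfFormula τ n) ∈ S) (x : Fin n → N) :
    RelMap (L := skolemLanguage S) (Sum.inr (equivShrink _ ⟨φ, hφ⟩)) x ↔ φ.Realize x := by
  -- A symbol at `x` in `N` reports the truth of its formula at a matching tuple `y` in `M`; the
  -- induction transports the satisfaction clauses from `M` back to `N`.
  have base : ∀ {n : ℕ} (φ : InfFormula τ n) (hφ : (⟨n, φ⟩ : Σ n, InfFormula τ n) ∈ S)
      {x : Fin n → N} {y : Fin n → M}, SameAtomicType (skolemLanguage S) x y →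
      (RelMap (L := skolemLanguage S) (Sum.inr (equivShrink _ ⟨φ, hφ⟩)) x ↔ φ.Realize y) := by
    intro n φ hφ x y hxy
    refine (hxy.rel_iff (Sum.inr (equivShrink _ ⟨φ, hφ⟩)) Term.var).trans ?_
    exact relMap_skolemStructure φ hφ y
  induction φ with
  | equal t₁ t₂ =>
    obtain ⟨y, hxy⟩ := hN _ x
    rw [base _ hφ hxy]
    have := hxy.eq_iff (LHom.sumInl.onTerm t₁) (LHom.sumInl.onTerm t₂)
    simp only [LHom.realize_onTerm] at this
    exact this.symm
  | rel R ts =>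
    obtain ⟨y, hxy⟩ := hN _ x
    rw [base _ hφ hxy]
    have := hxy.rel_iff (LHom.sumInl.onRelation R) (fun k => LHom.sumInl.onTerm (ts k))
    simp only [LHom.realize_onTerm, LHom.map_onRelation] at this
    exact this.symm
  | neg φ ih =>
    obtain ⟨y, hxy⟩ := hN _ x
    rw [base _ hφ hxy]
    exact not_congr ((base _ (hS.neg hφ) hxy).symm.trans (ih _ x))
  | disj ι φ ih =>
    obtain ⟨y, hxy⟩ := hN _ x
    rw [base _ hφ hxy]
    exact exists_congr fun k => (base _ (hS.disj hφ k) hxy).symm.trans (ih k _ x)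
  | @ex n φ ih =>
    constructor
    · intro h
      obtain ⟨y, hxy⟩ := hN _ x
      have hy : ∃ z : M, φ.Realize (Fin.snoc y z : Fin _ → M) := (base _ hφ hxy).1 h
      let f : (skolemLanguage S).Functions n := Sum.inr (equivShrink _ ⟨φ, hS.ex hφ⟩)
      -- The witness in `N` is the Skolem term at `x`: the extended tuple has the type of `y`
      -- extended by its Skolem value.
      let t : Fin (n + 1) → (skolemLanguage S).Term (Fin n) := Fin.snoc Term.var (Term.func f Term.var)
      have ht : ∀ (P : Type u) [(skolemLanguage S).Structure P] (v : Fin n → P),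
          (fun k => (t k).realize v) = (Fin.snoc v (funMap f v) : Fin _ → P) := by
        intro P _ v
        funext k
        refine Fin.lastCases ?_ (fun k => ?_) k
        · simp only [t, Fin.snoc_last, Term.realize_func, Term.realize_var]
        · simp only [t, Fin.snoc_castSucc, Term.realize_var]
      have hf : φ.Realize (Fin.snoc y (funMap f y) : Fin _ → M) :=
        realize_funMap_skolemStructure φ (hS.ex hφ) y hy
      have hsub := hxy.subst t
      rw [ht, ht] at hsub
      exact ⟨_, (ih (hS.ex hφ) _).1 ((base _ _ hsub).2 hf)⟩
    · rintro ⟨z, hz⟩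
      -- Here `x` and its witness are matched together, so that the last entry of `y` is a witness
      -- in `M`.
      obtain ⟨y, hxy⟩ := hN _ (Fin.snoc x z : Fin _ → N)
      have hy : φ.Realize y := (base _ (hS.ex hφ) hxy).1 ((ih _ _).2 hz)
      have hx := hxy.comp (Fin.castSucc : Fin n → Fin (n + 1))
      have hx' : (Fin.snoc x z : Fin (n + 1) → N) ∘ Fin.castSucc = x :=
        funext fun k => Fin.snoc_castSucc (α := fun _ => N) _ _ _
      rw [hx'] at hx
      refine (base _ hφ hx).2 ⟨y (Fin.last n), ?_⟩
      have : (Fin.snoc (y ∘ Fin.castSucc) (y (Fin.last n)) : Fin _ → M) = y := Fin.snoc_init_self y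
      rwa [this]

/-- Formulas in `S` are equivalent to atomic ones in these structures. Taking `N' = M` transfers
`T`; taking two Ehrenfeucht–Mostowski models transfers `F` along embeddings. -/
theorem SubformulaClosed.realize_iff (hS : SubformulaClosed S) (M : Type u) [τ.Structure M]
    [Nonempty M] {N N' : Type u}
    [τ.Structure N] [(skolemLanguage S).Structure N]
    [(LHom.sumInl : τ →ᴸ skolemLanguage S).IsExpansionOn N]
    [τ.Structure N'] [(skolemLanguage S).Structure N']
    [(LHom.sumInl : τ →ᴸ skolemLanguage S).IsExpansionOn N']
    (hN : ∀ (m : ℕ) (x : Fin m → N), ∃ y : Fin m → M, SameAtomicType (skolemLanguage S) x y)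
    (hN' : ∀ (m : ℕ) (x : Fin m → N'), ∃ y : Fin m → M, SameAtomicType (skolemLanguage S) x y)
    {n : ℕ} {φ : InfFormula τ n} (hφ : (⟨n, φ⟩ : Σ n, InfFormula τ n) ∈ S) {x : Fin n → N}
    {y : Fin n → N'} (h : SameAtomicType (skolemLanguage S) x y) : φ.Realize x ↔ φ.Realize y := by
  rw [← hS.relMap_iff_realize M N hN φ hφ, ← hS.relMap_iff_realize M N' hN' φ hφ]
  exact h.rel_iff (Sum.inr (equivShrink _ ⟨φ, hφ⟩)) Term.var

end Skolem

/-! ### Categories of models -/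

section ModCat

variable {τ : FirstOrder.Language.{u, u}} {T : Set (InfFormula τ 0)}
  {F : Set (Σ n : ℕ, InfFormula τ n)}

theorem InfFormula.realize_equiv {M N : Type u} [τ.Structure M] [τ.Structure N] (e : M ≃[τ] N)
    {n : ℕ} (φ : InfFormula τ n) (x : Fin n → M) : φ.Realize (e ∘ x) ↔ φ.Realize x := by
  induction φ with
  | equal t₁ t₂ =>
    simp only [InfFormula.Realize, HomClass.realize_term, e.injective.eq_iff]
  | rel R ts =>
    simp only [InfFormula.Realize, HomClass.realize_term]
    exact e.map_rel R _
  | neg φ ih => exact not_congr (ih x)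
  | disj ι φ ih => exact exists_congr fun k => ih k x
  | ex φ ih =>
    refine ⟨fun ⟨y, hy⟩ => ⟨e.symm y, ?_⟩, fun ⟨y, hy⟩ => ⟨e y, ?_⟩⟩
    · rw [← ih, Fin.comp_snoc, e.apply_symm_apply]
      exact hy
    · rw [← Fin.comp_snoc, ih]
      exact hy

/-- An isomorphism of structures is an isomorphism in every category of models. -/
def ModCat.isoOfEquiv {M N : ModCat T F} (e : M ≃[τ] N) : M ≅ N where
  hom := ModCat.Hom.mk e.toHom fun _ φ _ x h => (φ.realize_equiv e x).2 h
  inv := ModCat.Hom.mk e.symm.toHom fun _ φ _ x h => (φ.realize_equiv e.symm x).2 h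
  hom_inv_id := ModCat.Hom.ext (FirstOrder.Language.Hom.ext fun x => e.symm_apply_apply x)
  inv_hom_id := ModCat.Hom.ext (FirstOrder.Language.Hom.ext fun x => e.apply_symm_apply x)

/-- A category of models of bounded cardinality is essentially small. -/
theorem ModCat.essentiallySmall_of_card_le (κ : Cardinal.{u})
    (h : ∀ M : ModCat T F, Cardinal.mk M ≤ κ) : EssentiallySmall.{u} (ModCat T F) := by
  refine (essentiallySmall_iff _).2 ⟨?_, inferInstance⟩
  -- Up to isomorphism, every model lives on a subset of one fixed set of size `κ`, which leaves
  -- only a small set of structures.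
  let A := Σ' (s : Set κ.out) (str : τ.Structure s),
    ∀ φ ∈ T, φ.Realize (Fin.elim0 : Fin 0 → s)
  let q : A → Skeleton (ModCat T F) := fun a => toSkeleton (@ModCat.mk τ T F a.1 a.2.1 a.2.2)
  refine small_of_surjective (f := q) fun X => ?_
  obtain ⟨M, rfl⟩ : ∃ M, toSkeleton M = X := ⟨_, toSkeleton_fromSkeleton_obj X⟩
  have hM := h M
  rw [← κ.mk_out] at hM
  obtain ⟨i⟩ := hM
  let e : M ≃ Set.range i := Equiv.ofInjective i i.injective
  let str : τ.Structure (Set.range i) := e.inducedStructure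
  let e' : M ≃[τ] Set.range i := e.inducedStructureEquiv
  have models : ∀ φ ∈ T, φ.Realize (Fin.elim0 : Fin 0 → Set.range i) := fun φ hφ => by
    have := (φ.realize_equiv e' Fin.elim0).2 (M.models φ hφ)
    rwa [Subsingleton.elim (e' ∘ Fin.elim0) Fin.elim0] at this
  exact ⟨⟨_, str, models⟩, congr_toSkeleton_of_iso
    (ModCat.isoOfEquiv (N := @ModCat.mk τ T F _ str models) e').symm⟩

end ModCat

/-! ### Functors into categories of models -/

section Functor

variable {L τ : FirstOrder.Language.{u, u}} {K : OrderedAbstractClass L}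
  {T : Set (InfFormula τ 0)} {F : Set (Σ n : ℕ, InfFormula τ n)}

/-- A functor into a category of models whose maps are embeddings preserving and reflecting the
formulas in `F`, and whose values are finitarily generated over the members of the class, preserves
the directed colimits which are computed on underlying sets. -/
theorem preservesColimit_of_finitary (G : K.Obj ⥤ ModCat T F)
    (inj : ∀ {I J : K.Obj} (f : I ⟶ J), Function.Injective (G.map f))
    (rel : ∀ {I J : K.Obj} (f : I ⟶ J) {n : ℕ} (R : τ.Relations n) (x : Fin n → G.obj I),
      RelMap R (G.map f ∘ x) → RelMap R x)
    (form : ∀ {I J : K.Obj} (f : I ⟶ J) {n : ℕ} (φ : InfFormula τ n),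
      (⟨n, φ⟩ : Σ n : ℕ, InfFormula τ n) ∈ F → ∀ x : Fin n → G.obj I,
        φ.Realize (G.map f ∘ x) → φ.Realize x)
    (fin : ∀ {J : K.Obj} (x : G.obj J), ∃ s : Finset J, ∀ {I : K.Obj} (f : I ⟶ J),
      (s : Set J) ⊆ Set.range f → x ∈ Set.range (G.map f))
    {D : Type u} [Preorder D] [IsDirectedOrder D] [Nonempty D] (X : D ⥤ K.Obj)
    [Limits.PreservesColimit X K.underlying] : Limits.PreservesColimit X G := by
  classical
  refine ⟨fun {c} hc => ?_⟩
  have surj : ∀ i : c.pt, ∃ d, i ∈ Set.range (c.ι.app d) := fun i =>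
    Limits.Types.jointly_surjective_of_isColimit (Limits.isColimitOfPreserves K.underlying hc) i
  have mapX : ∀ {d d' : D} (h : d ≤ d') (y : G.obj (X.obj d)),
      G.map (c.ι.app d') (G.map (X.map (homOfLE h)) y) = G.map (c.ι.app d) y := fun h y => by
    rw [← c.w (homOfLE h), G.map_comp]
    rfl
  have cover : ∀ s : Finset c.pt, ∃ d, (s : Set c.pt) ⊆ Set.range (c.ι.app d) := by
    intro s
    choose d hd using surj
    obtain ⟨e, he⟩ := Finset.exists_le (s.image d)
    refine ⟨e, fun i hi => ?_⟩
    obtain ⟨y, hy⟩ := hd i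
    refine ⟨X.map (homOfLE (he _ (Finset.mem_image_of_mem d hi))) y, ?_⟩
    refine Eq.trans ?_ hy
    rw [← c.w (homOfLE (he _ (Finset.mem_image_of_mem d hi)))]
    rfl
  -- Finitely many elements have a joint finite support, and directedness places it in the image of
  -- a single stage.
  have lift : ∀ {n : ℕ} (x : Fin n → G.obj c.pt), ∃ d, ∃ y : Fin n → G.obj (X.obj d),
      G.map (c.ι.app d) ∘ y = x := by
    intro n x
    choose s hs using fun k => fin (x k)
    obtain ⟨d, hd⟩ := cover (Finset.univ.biUnion s)
    choose y hy using fun k => hs k (c.ι.app d)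
      ((Finset.coe_subset.2 (Finset.subset_biUnion_of_mem s (Finset.mem_univ k))).trans hd)
    exact ⟨d, y, funext hy⟩
  have lift₁ : ∀ x : G.obj c.pt, ∃ d, ∃ y : G.obj (X.obj d), G.map (c.ι.app d) y = x := fun x => by
    obtain ⟨d, y, hy⟩ := lift (fun _ : Fin 1 => x)
    exact ⟨d, y 0, congrFun hy 0⟩
  choose dd yy hyy using lift₁
  -- The value is independent of the chosen preimage: two preimages of `x` agree at a common later
  -- stage, since the map from there to the colimit is injective.
  have desc : ∀ (s : Limits.Cocone (X ⋙ G)) (d : D) (y : G.obj (X.obj d))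
      (x : G.obj c.pt), G.map (c.ι.app d) y = x → s.ι.app (dd x) (yy x) = s.ι.app d y := by
    intro s d y x hx
    obtain ⟨e, he, he'⟩ := exists_ge_ge (dd x) d
    have h₁ : G.map (X.map (homOfLE he)) (yy x) = G.map (X.map (homOfLE he')) y :=
      inj (c.ι.app e) (by rw [mapX, mapX, hyy, hx])
    rw [← s.w (homOfLE he), ← s.w (homOfLE he')]
    exact congrArg (fun z => s.ι.app e z) h₁
  have hdesc : ∀ (s : Limits.Cocone (X ⋙ G)) (d : D) {n : ℕ} (y : Fin n → G.obj (X.obj d)),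
      (fun x => s.ι.app (dd x) (yy x)) ∘ (G.map (c.ι.app d) ∘ y) = s.ι.app d ∘ y :=
    fun s d n y => funext fun k => desc s d (y k) _ rfl
  -- Relations and formulas of `F` holding at a tuple over the colimit point are first reflected to
  -- one stage and then preserved by the leg of the cocone.
  refine ⟨⟨fun s => ModCat.Hom.mk ⟨fun x => s.ι.app (dd x) (yy x), fun {n} f x => ?_,
    fun {n} R x hR => ?_⟩ fun n φ hφ x hx => ?_, fun s d => ?_, fun s m hm => ?_⟩⟩
  · obtain ⟨d, y, rfl⟩ := lift x
    have h₁ : funMap f (G.map (c.ι.app d) ∘ y) = G.map (c.ι.app d) (funMap f y) :=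
      (FirstOrder.Language.Hom.map_fun (G.map (c.ι.app d)).toHom f y).symm
    have h₂ : s.ι.app d (funMap f y) = funMap f (s.ι.app d ∘ y) :=
      FirstOrder.Language.Hom.map_fun (s.ι.app d).toHom f y
    refine (desc s d _ _ h₁.symm).trans (h₂.trans ?_)
    exact congrArg (funMap f) (hdesc s d y).symm
  · obtain ⟨d, y, rfl⟩ := lift x
    have h₂ : RelMap R (s.ι.app d ∘ y) :=
      FirstOrder.Language.Hom.map_rel (s.ι.app d).toHom R y (rel _ R y hR)
    rwa [← hdesc s d y] at h₂
  · obtain ⟨d, y, rfl⟩ := lift x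
    have h₂ : φ.Realize (s.ι.app d ∘ y) :=
      (s.ι.app d).preserves n φ hφ y (form _ φ hφ y hx)
    rwa [← hdesc s d y] at h₂
  · exact ModCat.Hom.ext (FirstOrder.Language.Hom.ext fun y => desc s d y _ rfl)
  · refine ModCat.Hom.ext (FirstOrder.Language.Hom.ext fun x => ?_)
    change m x = s.ι.app (dd x) (yy x)
    rw [← hm]
    exact congrArg (fun z => m z) (hyy x).symm

namespace OrderedAbstractClass

variable {τ₁ : FirstOrder.Language.{u, u}} {Φ : K.Blueprint τ₁}

theorem IsEM.exists_map {N : K.Obj → Type u} [∀ I, τ₁.Structure (N I)] {ι : ∀ I : K.Obj, I → N I}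
    (h : ∀ I, K.IsEM Φ I (N I) (ι I)) {I J : K.Obj} (f : I ⟶ J) :
    ∃ e : N I ↪[τ₁] N J, ∀ t : τ₁.Term I, e (t.realize (ι I)) = t.realize (ι J ∘ f) :=
  ((h I).sameAtomicType_map (h J) f).exists_embedding (h I).exists_term

/-- The functor formed by the reducts of Ehrenfeucht–Mostowski models. -/
def emFunctor (j : τ →ᴸ τ₁) (N : K.Obj → Type u) [∀ I, τ₁.Structure (N I)]
    (ι : ∀ I : K.Obj, I → N I) (gen : ∀ I (x : N I), ∃ t : τ₁.Term I, t.realize (ι I) = x)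
    (e : ∀ {I J : K.Obj} (_ : I ⟶ J), N I ↪[τ₁] N J)
    (he : ∀ {I J : K.Obj} (f : I ⟶ J) (t : τ₁.Term I), e f (t.realize (ι I)) = t.realize (ι J ∘ f))
    (models : ∀ I, letI := j.reduct (N I); ∀ φ ∈ T, φ.Realize (Fin.elim0 : Fin 0 → N I))
    (preserves : ∀ {I J : K.Obj} (f : I ⟶ J), letI := j.reduct (N I); letI := j.reduct (N J);
      ∀ (n : ℕ) (φ : InfFormula τ n), (⟨n, φ⟩ : Σ n : ℕ, InfFormula τ n) ∈ F →
        ∀ x : Fin n → N I, φ.Realize x → φ.Realize (e f ∘ x)) :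
    K.Obj ⥤ ModCat T F where
  obj I := @ModCat.mk τ T F (N I) (j.reduct (N I)) (models I)
  map {I J} f := ModCat.Hom.mk
    (@FirstOrder.Language.Hom.mk τ (N I) (N J) (j.reduct (N I)) (j.reduct (N J)) (e f)
      (fun g x => (e f).map_fun (j.onFunction g) x)
      (fun R x => ((e f).map_rel (j.onRelation R) x).2))
    (preserves f)
  map_id I := ModCat.Hom.ext (DFunLike.ext _ _ fun x => by
    obtain ⟨t, rfl⟩ := gen I x
    exact he (𝟙 I) t)
  map_comp {I J J'} f g := ModCat.Hom.ext (DFunLike.ext _ _ fun x => by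
    obtain ⟨t, rfl⟩ := gen I x
    change e (f ≫ g) (t.realize (ι I)) = e g (e f (t.realize (ι I)))
    rw [he, he]
    have := he g (t.relabel f)
    rw [Term.realize_relabel, Term.realize_relabel] at this
    exact this.symm)

end OrderedAbstractClass

end Functor

/-! ### Construction of the functor -/

theorem ModCat.exists_embedding_of_isLarge {τ : FirstOrder.Language.{u, u}}
    {T : Set (InfFormula τ 0)} {F : Set (Σ n : ℕ, InfFormula τ n)} (h : IsLarge.{u} (ModCat T F))
    (I : Type u) : ∃ M : ModCat T F, Nonempty M ∧ ∃ g : I → M, Function.Injective g := by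
  by_contra! hM
  -- The extra point in `Option I` makes `M` nonempty even when `I` is empty.
  refine h (ModCat.essentiallySmall_of_card_le (Cardinal.mk (Option I)) fun M => ?_)
  by_contra hlt
  obtain ⟨g⟩ := (not_le.1 hlt).le
  exact hM M ⟨g none⟩ (fun i => g (some i)) (g.injective.comp (Option.some_injective I))

/-- Ehrenfeucht–Mostowski functors into large categories of models exist. -/
theorem exists_isEMFunctor {L : FirstOrder.Language.{u, u}} {K : OrderedAbstractClass L}
    {g : K.Bigness} (hK : OrderedAbstractClass.IsErdosRado g) {τ : FirstOrder.Language.{u, u}}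
    (T : Set (InfFormula τ 0)) (F : Set (Σ n : ℕ, InfFormula τ n)) [Small.{u} T] [Small.{u} F]
    (hlarge : IsLarge.{u} (ModCat T F)) :
    ∃ (τ₁ : FirstOrder.Language.{u, u}) (j : τ →ᴸ τ₁) (Φ : K.Blueprint τ₁) (G : K.Obj ⥤ ModCat T F),
      j.Injective ∧ IsEMFunctor j Φ G ∧ G.Faithful ∧
      ∀ (D : Type u) [Preorder D] [IsDirectedOrder D] [Nonempty D] (X : D ⥤ K.Obj),
        Limits.PreservesColimit X K.underlying → Limits.PreservesColimit X G := by
  classical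
  obtain ⟨S, hA, hsmall, hS⟩ :=
    exists_subformulaClosed ((fun φ => (⟨0, φ⟩ : Σ n : ℕ, InfFormula τ n)) '' T ∪ F)
  have hT : ∀ φ ∈ T, (⟨0, φ⟩ : Σ n : ℕ, InfFormula τ n) ∈ S := fun φ hφ =>
    hA (Or.inl ⟨φ, hφ, rfl⟩)
  have hF : ∀ φ ∈ F, φ ∈ S := fun φ hφ => hA (Or.inr hφ)
  let τ₁ := skolemLanguage S
  let j : τ →ᴸ τ₁ := LHom.sumInl
  obtain ⟨f, hf⟩ := hK
  -- The expanded language depends only on `S`, so its cardinality can be fixed before `I₀` and `M`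
  -- are chosen.
  obtain ⟨⟨I₀, hI₀⟩, her⟩ := hf τ₁.card
  obtain ⟨M, _, h, hinj⟩ := ModCat.exists_embedding_of_isLarge hlarge I₀
  obtain ⟨Φ, hΦ⟩ := her τ₁ le_rfl I₀ hI₀ M h hinj
  replace hΦ : Φ.RealizedBy h := hΦ
  choose N str ι hEM using hΦ.exists_isEM hinj
  have hN : ∀ I (m : ℕ) (x : Fin m → N I), ∃ y : Fin m → M, SameAtomicType τ₁ x y :=
    fun I m x => (hEM I).exists_sameAtomicType hΦ x
  choose e he using fun {I J : K.Obj} (f : I ⟶ J) => OrderedAbstractClass.IsEM.exists_map hEM f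
  let red : ∀ I, τ.Structure (N I) := fun I => j.reduct (N I)
  have exp : ∀ I, (LHom.sumInl : τ →ᴸ skolemLanguage S).IsExpansionOn (N I) :=
    fun I => j.isExpansionOn_reduct (N I)
  have form : ∀ {I J : K.Obj} (f : I ⟶ J) (n : ℕ) (φ : InfFormula τ n), (⟨n, φ⟩ : Σ n : ℕ, InfFormula τ n) ∈ F →
        ∀ x : Fin n → N I, φ.Realize x ↔ φ.Realize (e f ∘ x) := by
    intro I J f n φ hφ x
    exact hS.realize_iff M (hN I) (hN J) (hF _ hφ) (SameAtomicType.of_embedding (e f) x)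
  have models : ∀ I, ∀ φ ∈ T, φ.Realize (Fin.elim0 : Fin 0 → N I) := by
    intro I φ hφ
    obtain ⟨y, hy⟩ := hN I 0 Fin.elim0
    -- The expansion of `M` trivially realizes only its own types, so a sentence of `T` is compared
    -- through the empty tuple.
    refine (hS.realize_iff M (hN I) (fun m x => ⟨x, SameAtomicType.refl x⟩) (hT φ hφ) hy).2 ?_
    rw [Subsingleton.elim y Fin.elim0]
    exact M.models φ hφ
  let G : K.Obj ⥤ ModCat T F := OrderedAbstractClass.emFunctor j N ι
    (fun I => (hEM I).exists_term) e he models (fun f n φ hφ x => (form f n φ hφ x).1)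
  have hG : ∀ {I J : K.Obj} (f : I ⟶ J) (n : ℕ) (σ : τ₁.Term (Fin n)) (a : Fin n → I),
      e f (σ.realize (fun k => ι I (a k))) = σ.realize (fun k => ι J (f (a k))) := by
    intro I J f n σ a
    have := he f (σ.relabel a)
    rwa [Term.realize_relabel, Term.realize_relabel] at this
  refine ⟨τ₁, j, Φ, G, LHom.sumInl_injective,
    ⟨str, ι, fun I => ⟨j.isExpansionOn_reduct (N I), hEM I⟩, fun I J f => hG f⟩,
    ⟨fun {I J f f'} hff => ?_⟩, fun D _ _ _ X _ => preservesColimit_of_finitary G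
      (fun f => (e f).injective) (fun f n R x => ((e f).map_rel (j.onRelation R) x).1)
      (fun f n φ hφ x => (form f n φ hφ x).2) (fun {J} x => ?_) X⟩
  · refine AbstractClass.Hom.ext (FirstOrder.Language.Embedding.ext fun i => (hEM J).injective ?_)
    have h₁ := he f (Term.var i)
    have h₂ := he f' (Term.var i)
    have h₃ : e f (ι I i) = e f' (ι I i) := congrArg (fun q : G.obj I ⟶ G.obj J => q (ι I i)) hff
    exact (h₁.symm.trans h₃).trans h₂
  · obtain ⟨n, t, a, rfl⟩ := (hEM J).generated x
    -- The support of an element consists of the generators in a term naming it; lifting them along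
    -- `f` lets the same term name a preimage.
    refine ⟨Finset.univ.image a, fun {I} f hs => ?_⟩
    choose b hb using fun k => hs (by simp : a k ∈ _)
    refine ⟨(t.realize (ι I ∘ b) : N I), (hG f n t b).trans ?_⟩
    exact congrArg (fun v => t.realize v) (funext fun k => congrArg (ι J) (hb k))

end ERClass

theorem mainTheorem8 {L : FirstOrder.Language.{u, u}} (K : ERClass.OrderedAbstractClass L)
    (g : K.Bigness) (hK : ERClass.OrderedAbstractClass.IsErdosRado g)
    (𝕂 : Type w) [Category.{v} 𝕂] (hlarge : ERClass.IsLarge.{u} 𝕂)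
    (τ : FirstOrder.Language.{u, u}) (P : ERClass.ElementaryPresentation 𝕂 τ) :
    ∃ (τ₁ : FirstOrder.Language.{u, u}) (j : τ →ᴸ τ₁) (Φ : K.Blueprint τ₁) (G : K.Obj ⥤ ERClass.ModCat P.T P.F),
      j.Injective ∧ ERClass.IsEMFunctor j Φ G ∧
      (G ⋙ P.equiv.functor).Faithful ∧
      ∀ (D : Type u) [Preorder D] [IsDirectedOrder D] [Nonempty D] (X : D ⥤ K.Obj),
        Limits.PreservesColimit X K.underlying →
          Limits.PreservesColimit X (G ⋙ P.equiv.functor) := by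
  have := P.small_T
  have := P.small_F
  obtain ⟨τ₁, j, Φ, G, hj, hG, hfaith, hcolim⟩ := ERClass.exists_isEMFunctor hK P.T P.F
    fun h => hlarge ((essentiallySmall_congr P.equiv).1 h)
  exact ⟨τ₁, j, Φ, G, hj, hG, inferInstance, fun D _ _ _ X hX =>
    have := hcolim D X hX
    inferInstance⟩
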